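/- Let $n>1$ be an integer. There is no algebraic fibration $f\colon \mathbb P^n\to\mathbb P^1$, where $\mathbb P^n$ and $\mathbb P^1$ denote the projective spaces over $\mathbb C$ and an algebraic fibration means a surjective morphism of algebraic varieties over $\mathbb C$ (nothing further, such as smoothness, flatness, local triviality or connectedness of the fibres, is required). -/

import Mathlib

open AlgebraicGeometry CategoryTheory

attribute [local instance] MvPolynomial.gradedAlgebra

/-- Projective `n`-space `ℙⁿ` over `ℂ`, as the scheme `Proj ℂ[x₀, …, xₙ]`, where the polynomial
ring carries its grading by total degree. -/
noncomputable def ComplexProjectiveSpace (n : ℕ) : Scheme.{0} :=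
  Proj (MvPolynomial.homogeneousSubmodule (Fin (n + 1)) ℂ)

/-- The structure morphism `ℙⁿ ⟶ Spec ℂ`: the canonical morphism from `Proj` to the spectrum of the
degree-zero part of the graded ring, followed by the morphism induced by the inclusion of the
constants `ℂ` into the degree-zero part. -/
noncomputable def ComplexProjectiveSpace.structureMorphism (n : ℕ) :
    ComplexProjectiveSpace n ⟶ Spec (CommRingCat.of ℂ) :=
  Proj.toSpecZero (MvPolynomial.homogeneousSubmodule (Fin (n + 1)) ℂ) ≫
    Spec.map (CommRingCat.ofHom
      (algebraMap ℂ (MvPolynomial.homogeneousSubmodule (Fin (n + 1)) ℂ 0)))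

/-- An algebraic fibration `ℙⁿ ⟶ ℙᵐ` is a surjective morphism of complex algebraic varieties, i.e. a
surjective morphism of schemes over `Spec ℂ`. No smoothness, flatness, local triviality or
connectedness of the fibres is asked for. -/
structure IsAlgebraicFibration {n m : ℕ}
    (f : ComplexProjectiveSpace n ⟶ ComplexProjectiveSpace m) : Prop where
  comp_structureMorphism : f ≫ ComplexProjectiveSpace.structureMorphism m =
    ComplexProjectiveSpace.structureMorphism n
  surjective : Function.Surjective f

/-! A map to `ℙ¹` is given at the generic point by a rational function `T`, the pullback of `X 1 / X
0`, with inverse `S`. Write `T = a' / b'` in lowest terms. Surjectivity gives a point where `T`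
vanishes and one where `S` vanishes, so neither `a'` nor `b'` has a constant term. By Krull's height
theorem a minimal prime over `(a', b')` has height at most 2, less than `n + 1`, so it yields a
point `q` of `ℙⁿ`: two hypersurfaces meet. By coprimality every denominator of `T` or `S` vanishes
at `q`, yet one of `T`, `S` must be regular there, since `f q` lies in one of the two charts
(`exists_isPrime_mem_denominators`). -/

namespace MvPolynomial

/-! ### Heights and common zeros in polynomial rings -/

/-- The specialisation of the first `k` variables to zero. -/
noncomputable def specializeInitial (n k : ℕ) :
    MvPolynomial (Fin n) ℂ →ₐ[ℂ] MvPolynomial (Fin n) ℂ :=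
  aeval fun i : Fin n ↦ if (i : ℕ) < k then 0 else X i

@[simp]
theorem specializeInitial_X {n k : ℕ} (i : Fin n) :
    specializeInitial n k (X i) = if (i : ℕ) < k then 0 else X i :=
  aeval_X _ _

theorem specializeInitial_comp_of_le (n : ℕ) {k l : ℕ} (hkl : k ≤ l) :
    (specializeInitial n l).comp (specializeInitial n k) = specializeInitial n l := by
  ext1 i
  rw [AlgHom.comp_apply, specializeInitial_X, specializeInitial_X]
  by_cases h : (i : ℕ) < k
  · rw [if_pos h, if_pos (h.trans_le hkl), map_zero]
  · rw [if_neg h, specializeInitial_X]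

/-- The prime ideal generated by the first `k` variables. -/
noncomputable def initialVariablesIdeal (n k : ℕ) : Ideal (MvPolynomial (Fin n) ℂ) :=
  RingHom.ker (specializeInitial n k)

theorem mem_initialVariablesIdeal {n k : ℕ} {p : MvPolynomial (Fin n) ℂ} :
    p ∈ initialVariablesIdeal n k ↔ specializeInitial n k p = 0 :=
  RingHom.mem_ker

instance initialVariablesIdeal_isPrime (n k : ℕ) : (initialVariablesIdeal n k).IsPrime :=
  RingHom.ker_isPrime _

theorem X_mem_initialVariablesIdeal_iff {n k : ℕ} (i : Fin n) :
    X i ∈ initialVariablesIdeal n k ↔ (i : ℕ) < k := by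
  rw [mem_initialVariablesIdeal, specializeInitial_X]
  split_ifs with h <;> simp [h]

theorem initialVariablesIdeal_mono (n : ℕ) : Monotone (initialVariablesIdeal n) := by
  intro k l hkl p hp
  rw [mem_initialVariablesIdeal] at hp ⊢
  rw [← specializeInitial_comp_of_le n hkl, AlgHom.comp_apply, hp, map_zero]

theorem initialVariablesIdeal_lt_succ {n k : ℕ} (hk : k < n) :
    initialVariablesIdeal n k < initialVariablesIdeal n (k + 1) := by
  refine lt_of_le_of_ne (initialVariablesIdeal_mono n k.le_succ) fun h ↦ ?_
  have h₁ : X ⟨k, hk⟩ ∈ initialVariablesIdeal n (k + 1) := by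
    simp [X_mem_initialVariablesIdeal_iff]
  rw [← h, X_mem_initialVariablesIdeal_iff] at h₁
  exact lt_irrefl _ h₁

/-- Each further variable makes the prime strictly larger, so the height grows by at least one. -/
theorem le_height_initialVariablesIdeal {n k : ℕ} (hk : k ≤ n) :
    (k : ℕ∞) ≤ (initialVariablesIdeal n k).height := by
  induction k with
  | zero => simp
  | succ k ih =>
    push_cast
    exact (add_le_add_left (ih (by omega)) 1).trans
      (Ideal.height_add_one_le_of_lt_of_isPrime (initialVariablesIdeal_lt_succ hk))

theorem constantCoeff_eq_zero_of_mem_initialVariablesIdeal {n k : ℕ}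
    {p : MvPolynomial (Fin n) ℂ} (hp : p ∈ initialVariablesIdeal n k) : constantCoeff p = 0 := by
  have h : (constantCoeff (R := ℂ) (σ := Fin n)) =
      constantCoeff.comp (specializeInitial n k).toRingHom := by
    ext i
    · simp
    · by_cases h : (i : ℕ) < k <;> simp [h]
  rw [mem_initialVariablesIdeal] at hp
  rw [h, RingHom.comp_apply, AlgHom.toRingHom_eq_coe, AlgHom.coe_toRingHom, hp, map_zero]

theorem mem_irrelevant_iff_constantCoeff {n : ℕ} (p : MvPolynomial (Fin n) ℂ) :
    p ∈ HomogeneousIdeal.irrelevant (homogeneousSubmodule (Fin n) ℂ) ↔ constantCoeff p = 0 := by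
  rw [HomogeneousIdeal.mem_irrelevant_iff, GradedRing.proj_apply]
  change ((decomposition.decompose' p 0 : _) : MvPolynomial (Fin n) ℂ) = 0 ↔ _
  rw [decomposition.decompose'_apply, homogeneousComponent_zero]
  simp [constantCoeff_eq]

/-- Every proper homogeneous ideal is contained in the ideal of polynomials without constant
term. -/
theorem constantCoeff_eq_zero_of_mem {n : ℕ}
    (I : HomogeneousIdeal (homogeneousSubmodule (Fin n) ℂ)) (hI : I.toIdeal ≠ ⊤)
    {p : MvPolynomial (Fin n) ℂ} (hp : p ∈ I) : constantCoeff p = 0 := by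
  by_contra h
  have h₀ := I.isHomogeneous 0 hp
  change ((decomposition.decompose' p 0 : _) : MvPolynomial (Fin n) ℂ) ∈ _ at h₀
  rw [decomposition.decompose'_apply, homogeneousComponent_zero] at h₀
  exact hI (Ideal.eq_top_of_isUnit_mem _ h₀ ((isUnit_iff_ne_zero.mpr h).map C))

/-- Two polynomials in at least three variables without constant term lie in a common prime ideal
that does not contain the irrelevant ideal. -/
theorem exists_isPrime_mem_mem_not_irrelevant_le {n : ℕ} (hn : 2 < n)
    {a b : MvPolynomial (Fin n) ℂ} (ha : constantCoeff a = 0) (hb : constantCoeff b = 0) :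
    ∃ p : Ideal (MvPolynomial (Fin n) ℂ), p.IsPrime ∧ a ∈ p ∧ b ∈ p ∧
      ¬ (HomogeneousIdeal.irrelevant (homogeneousSubmodule (Fin n) ℂ)).toIdeal ≤ p := by
  classical
  have hprime : (RingHom.ker (constantCoeff (R := ℂ) (σ := Fin n))).IsPrime :=
    RingHom.ker_isPrime _
  have hle : Ideal.span (({a, b} : Finset (MvPolynomial (Fin n) ℂ)) : Set _) ≤
      RingHom.ker (constantCoeff (R := ℂ) (σ := Fin n)) := by
    rw [Ideal.span_le]
    intro x hx
    simp only [Finset.coe_insert, Finset.coe_singleton, Set.mem_insert_iff,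
      Set.mem_singleton_iff] at hx
    rcases hx with rfl | rfl <;> simpa [RingHom.mem_ker]
  obtain ⟨p, hp, -⟩ := Ideal.exists_minimalPrimes_le hle
  refine ⟨p, hp.1.1, hp.1.2 (Ideal.subset_span (by simp)),
    hp.1.2 (Ideal.subset_span (by simp)), fun h ↦ ?_⟩
  -- Krull's height theorem for two generators; containing the irrelevant ideal would force height
  -- at least 3.
  have h₂ : p.height ≤ 2 := (Ideal.height_le_card_of_mem_minimalPrimes_span_finset hp).trans
    (by exact_mod_cast Finset.card_le_two)
  have h₃ : initialVariablesIdeal n 3 ≤ p := fun x hx ↦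
    h ((mem_irrelevant_iff_constantCoeff x).mpr (constantCoeff_eq_zero_of_mem_initialVariablesIdeal hx))
  have h₄ := (le_height_initialVariablesIdeal (n := n) (k := 3) hn).trans (Ideal.height_mono h₃)
  exact absurd (h₄.trans h₂) (by decide)

end MvPolynomial

/-- Let `T` be a fraction of polynomials in at least three variables with inverse `S`. If both
vanish somewhere, then some homogeneous prime ideal not containing the irrelevant ideal contains
every homogeneous denominator of `T` and every homogeneous denominator of `S`. -/
theorem MvPolynomial.exists_isPrime_mem_denominators {n : ℕ} (hn : 2 < n) {K : Type*} [CommRing K]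
    [IsDomain K] [Algebra (MvPolynomial (Fin n) ℂ) K]
    (hinj : Function.Injective (algebraMap (MvPolynomial (Fin n) ℂ) K)) {T S : K} (hTS : T * S = 1)
    (I J : HomogeneousIdeal (homogeneousSubmodule (Fin n) ℂ)) (hI : I.toIdeal.IsPrime)
    (hJ : J.toIdeal.IsPrime) {a b c d : MvPolynomial (Fin n) ℂ}
    (hab : T * algebraMap _ K b = algebraMap _ K a) (ha : a ∈ I) (hb : b ∉ I)
    (hcd : S * algebraMap _ K d = algebraMap _ K c) (hc : c ∈ J) (hd : d ∉ J) :
    ∃ p : Ideal (MvPolynomial (Fin n) ℂ), p.IsPrime ∧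
      ¬ (HomogeneousIdeal.irrelevant (homogeneousSubmodule (Fin n) ℂ)).toIdeal ≤ p ∧
      (∀ x y : MvPolynomial (Fin n) ℂ, T * algebraMap _ K y = algebraMap _ K x → y ∈ p) ∧
      (∀ x y : MvPolynomial (Fin n) ℂ, S * algebraMap _ K y = algebraMap _ K x → y ∈ p) := by
  have hb₀ : b ≠ 0 := fun h ↦ hb (h ▸ I.toIdeal.zero_mem)
  -- Lowest terms, by unique factorization. Homogeneity of `a'` and `b'` is not needed.
  obtain ⟨a', b', g, hrel, rfl, rfl⟩ :=
    UniqueFactorizationMonoid.exists_reduced_factors' a b hb₀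
  have hg : algebraMap _ K g ≠ 0 := by
    rw [Ne, map_eq_zero_iff _ hinj]
    exact left_ne_zero_of_mul hb₀
  have hT : T * algebraMap _ K b' = algebraMap _ K a' := by
    apply mul_left_cancel₀ hg
    rw [map_mul, map_mul] at hab
    rw [← hab]
    ring
  have hS : S * algebraMap _ K a' = algebraMap _ K b' := by
    rw [← hT, ← mul_assoc, mul_comm S T, hTS, one_mul]
  have hT' (x y : MvPolynomial (Fin n) ℂ) (h : T * algebraMap _ K y = algebraMap _ K x) :
      a' * y = b' * x := by
    apply hinj
    rw [map_mul, map_mul, ← hT, ← h]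
    ring
  have hS' (x y : MvPolynomial (Fin n) ℂ) (h : S * algebraMap _ K y = algebraMap _ K x) :
      b' * y = a' * x := by
    apply hinj
    rw [map_mul, map_mul, ← hS, ← h]
    ring
  have haI : a' ∈ I :=
    (hI.mem_or_mem (hT' _ _ hab ▸ I.toIdeal.mul_mem_left b' ha : a' * (g * b') ∈ I.toIdeal)
      ).resolve_right hb
  have hbJ : b' ∈ J :=
    (hJ.mem_or_mem (hS' _ _ hcd ▸ J.toIdeal.mul_mem_left a' hc : b' * d ∈ J.toIdeal)
      ).resolve_right hd
  obtain ⟨p, hp, hap, hbp, hirr⟩ := exists_isPrime_mem_mem_not_irrelevant_le hn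
    (constantCoeff_eq_zero_of_mem I hI.ne_top haI) (constantCoeff_eq_zero_of_mem J hJ.ne_top hbJ)
  exact ⟨p, hp, hirr,
    -- From `a' * y = b' * x` and coprimality, `b'` divides `y`.
    fun x y h ↦ p.mem_of_dvd (hrel.symm.dvd_of_dvd_mul_left ⟨x, hT' x y h⟩) hbp,
    fun x y h ↦ p.mem_of_dvd (hrel.dvd_of_dvd_mul_left ⟨x, hS' x y h⟩) hap⟩

/-! ### Values of sections on `Proj` -/

namespace AlgebraicGeometry.Proj

universe u
variable {A : Type u} {σ : Type*} [CommRing A] [SetLike σ A] [AddSubgroupClass σ A]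
  {𝒜 : ℕ → σ} [GradedRing 𝒜]

instance isPrime_asHomogeneousIdeal (x : Proj 𝒜) : x.asHomogeneousIdeal.toIdeal.IsPrime :=
  ProjectiveSpectrum.isPrime x

/-- The value at a point of a section of the structure sheaf of `Proj`, as an element of the
localization at the corresponding homogeneous prime ideal. -/
noncomputable def value {V : (Proj 𝒜).Opens} (x : Proj 𝒜) (hx : x ∈ V) :
    Γ(Proj 𝒜, V) →+* Localization.AtPrime x.asHomogeneousIdeal.toIdeal :=
  (algebraMap (HomogeneousLocalization.AtPrime 𝒜 x.asHomogeneousIdeal.toIdeal) _).comp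
    (openToLocalization 𝒜 V x hx).hom

theorem value_res {V W : (Proj 𝒜).Opens} (h : W ≤ V) (x : Proj 𝒜) (hx : x ∈ W)
    (t : Γ(Proj 𝒜, V)) :
    value x hx ((Proj 𝒜).presheaf.map (homOfLE h).op t) = value x (h hx) t :=
  rfl

theorem mem_basicOpen_section_iff_isUnit_value {V : (Proj 𝒜).Opens} {x : Proj 𝒜} (hx : x ∈ V)
    (t : Γ(Proj 𝒜, V)) : x ∈ (Proj 𝒜).basicOpen t ↔ IsUnit (value x hx t) := by
  rw [Scheme.mem_basicOpen _ _ _ hx]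
  refine (MulEquiv.isUnit_map (stalkIso' 𝒜 x)).symm.trans ?_
  refine Iff.trans ?_ (HomogeneousLocalization.isUnit_iff_isUnit_val 𝒜
    x.asHomogeneousIdeal.toIdeal (t.1 ⟨x, hx⟩)).symm
  exact iff_of_eq (congrArg IsUnit (stalkIso'_germ 𝒜 V x hx t))

theorem exists_value_eq_div {V : (Proj 𝒜).Opens} (t : Γ(Proj 𝒜, V)) {x : Proj 𝒜} (hx : x ∈ V) :
    ∃ (W : (Proj 𝒜).Opens) (_ : W ≤ V) (i : ℕ) (a b : A), x ∈ W ∧ a ∈ 𝒜 i ∧ b ∈ 𝒜 i ∧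
      ∀ (y : Proj 𝒜) (hy : y ∈ V), y ∈ W → b ∉ y.asHomogeneousIdeal ∧
        value y hy t * algebraMap A _ b = algebraMap A _ a := by
  obtain ⟨W, hxW, i, d, a, b, hb, hab⟩ := t.2 ⟨x, hx⟩
  refine ⟨W, i.le, d, a, b, hxW, a.2, b.2, fun y hy hyW ↦ ⟨hb ⟨y, hyW⟩, ?_⟩⟩
  have h : value y hy t = (HomogeneousLocalization.mk ⟨d, a, b, hb ⟨y, hyW⟩⟩ :
      HomogeneousLocalization.AtPrime 𝒜 y.asHomogeneousIdeal.toIdeal).val :=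
    congrArg HomogeneousLocalization.val (hab ⟨y, hyW⟩)
  rw [h, HomogeneousLocalization.val_mk, Localization.mk_eq_mk']
  exact IsLocalization.mk'_spec _ _ _

/-- The generic point of `Proj` is in every nonempty open subset. -/
theorem mem_of_toIdeal_eq_bot {η : Proj 𝒜} (hη : η.asHomogeneousIdeal.toIdeal = ⊥)
    {V : (Proj 𝒜).Opens} {x : Proj 𝒜} (hx : x ∈ V) : η ∈ V := by
  obtain ⟨_, ⟨_, ⟨f, rfl⟩, rfl⟩, hf, hfV⟩ :=
    (isBasis_basicOpen 𝒜).exists_subset_of_mem_open hx V.2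
  refine hfV ((mem_basicOpen 𝒜 f η).mpr fun h ↦ ?_)
  have h₀ : f ∈ η.asHomogeneousIdeal.toIdeal := h
  rw [hη, Ideal.mem_bot] at h₀
  subst h₀
  exact hf x.asHomogeneousIdeal.toIdeal.zero_mem

/-- A section is near each point a homogeneous fraction, which determines its value at the generic
point. -/
theorem exists_generic_value_eq_div {η : Proj 𝒜} (hη : η.asHomogeneousIdeal.toIdeal = ⊥)
    {V : (Proj 𝒜).Opens} (hηV : η ∈ V) (t : Γ(Proj 𝒜, V)) {x : Proj 𝒜} (hx : x ∈ V) :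
    ∃ (i : ℕ) (a b : A), a ∈ 𝒜 i ∧ b ∈ 𝒜 i ∧ b ∉ x.asHomogeneousIdeal ∧
      (x ∈ (Proj 𝒜).basicOpen t ↔ a ∉ x.asHomogeneousIdeal) ∧
      value η hηV t * algebraMap A _ b = algebraMap A _ a := by
  obtain ⟨W, hWV, i, a, b, hxW, ha, hb, h⟩ := exists_value_eq_div t hx
  refine ⟨i, a, b, ha, hb, (h x hx hxW).1, ?_, (h η hηV (mem_of_toIdeal_eq_bot hη hxW)).2⟩
  -- The denominator is a unit at `x`, so the value is a unit exactly when the numerator is.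
  have hu : IsUnit (algebraMap A (Localization.AtPrime x.asHomogeneousIdeal.toIdeal) b) :=
    IsLocalization.map_units _ (⟨b, (h x hx hxW).1⟩ : x.asHomogeneousIdeal.toIdeal.primeCompl)
  rw [mem_basicOpen_section_iff_isUnit_value hx]
  refine Iff.trans ?_ (IsLocalization.AtPrime.isUnit_to_map_iff
    (Localization.AtPrime x.asHomogeneousIdeal.toIdeal) x.asHomogeneousIdeal.toIdeal a)
  rw [← (h x hx hxW).2, IsUnit.mul_iff, and_iff_left hu]

end AlgebraicGeometry.Proj

/-! ### Homogeneous fractions as sections, and their pullbacks -/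

namespace AlgebraicGeometry.Proj

universe u
variable {A : Type u} {σ : Type*} [CommRing A] [SetLike σ A] [AddSubgroupClass σ A]
  {𝒜 : ℕ → σ} [GradedRing 𝒜]

theorem section_ext {V : (Proj 𝒜).Opens} {s t : Γ(Proj 𝒜, V)}
    (h : ∀ (x : Proj 𝒜) (hx : x ∈ V), value x hx s = value x hx t) : s = t :=
  Subtype.ext <| funext fun x ↦ HomogeneousLocalization.val_injective _ (h x.1 x.2)

/-- The fraction `g / f` of homogeneous elements of the same degree, as a section over `D₊(f)`. -/
noncomputable def fraction {d : ℕ} {f g : A} (hf : f ∈ 𝒜 d) (hg : g ∈ 𝒜 d) :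
    Γ(Proj 𝒜, basicOpen 𝒜 f) :=
  ⟨fun y ↦ .mk ⟨d, ⟨g, hg⟩, ⟨f, hf⟩, y.2⟩,
    fun y ↦ ⟨basicOpen 𝒜 f, y.2, 𝟙 _, d, ⟨g, hg⟩, ⟨f, hf⟩, fun z ↦ z.2, fun _ ↦ rfl⟩⟩

theorem value_fraction {d : ℕ} {f g : A} (hf : f ∈ 𝒜 d) (hg : g ∈ 𝒜 d) (x : Proj 𝒜)
    (hx : x ∈ basicOpen 𝒜 f) :
    value x hx (fraction hf hg) = IsLocalization.mk' _ g
      (⟨f, hx⟩ : x.asHomogeneousIdeal.toIdeal.primeCompl) :=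
  (HomogeneousLocalization.val_mk _).trans (Localization.mk_eq_mk'_apply _ _)

theorem basicOpen_fraction {d : ℕ} {f g : A} (hf : f ∈ 𝒜 d) (hg : g ∈ 𝒜 d) :
    (Proj 𝒜).basicOpen (fraction hf hg) = basicOpen 𝒜 f ⊓ basicOpen 𝒜 g := by
  ext x
  by_cases hx : x ∈ basicOpen 𝒜 f
  · have h := mem_basicOpen_section_iff_isUnit_value hx (fraction hf hg)
    rw [value_fraction, IsLocalization.AtPrime.isUnit_mk'_iff _ x.asHomogeneousIdeal.toIdeal] at h
    exact h.trans ⟨fun h' ↦ ⟨hx, h'⟩, fun h' ↦ h'.2⟩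
  · exact ⟨fun h ↦ (hx ((Proj 𝒜).basicOpen_le _ h)).elim, fun h ↦ (hx h.1).elim⟩

theorem fraction_mul_fraction {d : ℕ} {f g : A} (hf : f ∈ 𝒜 d) (hg : g ∈ 𝒜 d)
    {W : (Proj 𝒜).Opens} (hWf : W ≤ basicOpen 𝒜 f) (hWg : W ≤ basicOpen 𝒜 g) :
    (Proj 𝒜).presheaf.map (homOfLE hWf).op (fraction hf hg) *
      (Proj 𝒜).presheaf.map (homOfLE hWg).op (fraction hg hf) = 1 := by
  refine section_ext fun x hx ↦ ?_
  rw [map_mul, map_one, value_res, value_res, value_fraction, value_fraction]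
  exact IsLocalization.mk'_mul_mk'_eq_one ⟨g, hWg hx⟩ ⟨f, hWf hx⟩

/-- The two fractions live on different charts; they are inverse on the overlap, and pullback
commutes with restriction. -/
theorem value_app_fraction_mul {B : Type u} {τ : Type*} [CommRing B] [SetLike τ B]
    [AddSubgroupClass τ B] {ℬ : ℕ → τ} [GradedRing ℬ] (φ : Proj ℬ ⟶ Proj 𝒜) {d : ℕ} {f g : A}
    (hf : f ∈ 𝒜 d) (hg : g ∈ 𝒜 d) (x : Proj ℬ) (hxf : x ∈ φ ⁻¹ᵁ basicOpen 𝒜 f)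
    (hxg : x ∈ φ ⁻¹ᵁ basicOpen 𝒜 g) :
    value x hxf (φ.app _ (fraction hf hg)) * value x hxg (φ.app _ (fraction hg hf)) = 1 := by
  have h := congrArg (value (V := φ ⁻¹ᵁ (basicOpen 𝒜 f ⊓ basicOpen 𝒜 g)) x ⟨hxf, hxg⟩)
    (congrArg (φ.app _) (fraction_mul_fraction hf hg inf_le_left inf_le_right))
  rw [map_mul, map_mul, map_one, map_one] at h
  have h₁ (U U' : (Proj 𝒜).Opens) (hU : U' ≤ U) (hx : x ∈ φ ⁻¹ᵁ U') (t : Γ(Proj 𝒜, U)) :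
      value x hx (φ.app U' ((Proj 𝒜).presheaf.map (homOfLE hU).op t)) =
      value x (hU hx : x ∈ φ ⁻¹ᵁ U) (φ.app U t) := by
    rw [← CommRingCat.comp_apply, φ.naturality, CommRingCat.comp_apply]
    rfl
  exact (congrArg₂ (· * ·) (h₁ _ _ inf_le_left ⟨hxf, hxg⟩ (fraction hf hg))
    (h₁ _ _ inf_le_right ⟨hxf, hxg⟩ (fraction hg hf))).symm.trans h

end AlgebraicGeometry.Proj

/-! ### Points of projective space and the main theorem -/

open MvPolynomial

theorem MvPolynomial.irrelevant_le_idealOfVars (n : ℕ) :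
    (HomogeneousIdeal.irrelevant (homogeneousSubmodule (Fin n) ℂ)).toIdeal ≤
      idealOfVars (Fin n) ℂ := by
  intro p hp
  rw [← pow_one (idealOfVars (Fin n) ℂ), mem_pow_idealOfVars_iff']
  intro d hd
  obtain rfl := (Finsupp.degree_eq_zero_iff d).mp (Nat.lt_one_iff.mp hd)
  exact (mem_irrelevant_iff_constantCoeff p).mp hp

/-- The generic point of projective space. -/
noncomputable def ComplexProjectiveSpace.genericPoint (n : ℕ) :
    Proj (homogeneousSubmodule (Fin (n + 1)) ℂ) where
  asHomogeneousIdeal := ⊥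
  isPrime := by simpa using Ideal.isPrime_bot
  not_irrelevant_le h := by
    have h₀ : (X 0 : MvPolynomial (Fin (n + 1)) ℂ) ∈ (⊥ : HomogeneousIdeal _).toIdeal :=
      h ((mem_irrelevant_iff_constantCoeff _).mpr (constantCoeff_X ℂ _))
    simp at h₀

/-- The point of the projective line where one given coordinate vanishes. -/
theorem ComplexProjectiveSpace.exists_coordinate_mem {i j : Fin 2} (hij : i ≠ j) :
    ∃ x : Proj (homogeneousSubmodule (Fin (1 + 1)) ℂ),
      (X i : MvPolynomial (Fin (1 + 1)) ℂ) ∉ x.asHomogeneousIdeal ∧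
      (X j : MvPolynomial (Fin (1 + 1)) ℂ) ∈ x.asHomogeneousIdeal := by
  have hprime : (Ideal.span {(X j : MvPolynomial (Fin (1 + 1)) ℂ)}).IsPrime :=
    (Ideal.span_singleton_prime (X_ne_zero j)).mpr X_prime
  have hi : (X i : MvPolynomial (Fin (1 + 1)) ℂ) ∉
      Ideal.span {(X j : MvPolynomial (Fin (1 + 1)) ℂ)} := by
    rw [Ideal.mem_span_singleton, X_dvd_X]
    exact hij.symm
  refine ⟨⟨⟨Ideal.span {X j}, Ideal.homogeneous_span _ _ ?_⟩, hprime, fun h ↦ hi ?_⟩, hi,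
    Ideal.mem_span_singleton_self _⟩
  · rintro _ rfl
    exact ⟨1, isHomogeneous_X _ _⟩
  · exact h ((mem_irrelevant_iff_constantCoeff _).mpr (constantCoeff_X ℂ _))

theorem mainTheorem11 (n : ℕ) (hn : 1 < n) :
    ¬ ∃ f : ComplexProjectiveSpace n ⟶ ComplexProjectiveSpace 1, IsAlgebraicFibration f := by
  rintro ⟨f, -, hf⟩
  change Proj (homogeneousSubmodule (Fin (n + 1)) ℂ) ⟶
    Proj (homogeneousSubmodule (Fin (1 + 1)) ℂ) at f
  let η := ComplexProjectiveSpace.genericPoint n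
  have hη : η.asHomogeneousIdeal.toIdeal = ⊥ := rfl
  have hX (i : Fin 2) : (X i : MvPolynomial (Fin (1 + 1)) ℂ) ∈
      homogeneousSubmodule (Fin (1 + 1)) ℂ 1 :=
    isHomogeneous_X _ _
  have hpoint {i j : Fin 2} (hij : i ≠ j) : ∃ x : Proj (homogeneousSubmodule (Fin (n + 1)) ℂ),
      x ∈ f ⁻¹ᵁ Proj.basicOpen _ (X i) ∧
      x ∉ (Proj _).basicOpen (f.app _ (Proj.fraction (hX i) (hX j))) := by
    obtain ⟨y, hyi, hyj⟩ := ComplexProjectiveSpace.exists_coordinate_mem hij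
    obtain ⟨x, rfl⟩ := hf y
    refine ⟨x, hyi, ?_⟩
    rw [← Scheme.preimage_basicOpen, Proj.basicOpen_fraction]
    exact fun h ↦ h.2 hyj
  -- `P` is a zero of the pullback of `X 1 / X 0`, and `Q` one of the pullback of `X 0 / X 1`.
  obtain ⟨P, hP, hP'⟩ := hpoint (i := 0) (j := 1) (by decide)
  obtain ⟨Q, hQ, hQ'⟩ := hpoint (i := 1) (j := 0) (by decide)
  have hη₀ := Proj.mem_of_toIdeal_eq_bot hη hP
  have hη₁ := Proj.mem_of_toIdeal_eq_bot hη hQ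
  have hTS := Proj.value_app_fraction_mul f (hX 0) (hX 1) η hη₀ hη₁
  have hle : η.asHomogeneousIdeal.toIdeal.primeCompl ≤
      nonZeroDivisors (MvPolynomial (Fin (n + 1)) ℂ) :=
    Ideal.primeCompl_le_nonZeroDivisors _
  have : IsDomain (Localization.AtPrime η.asHomogeneousIdeal.toIdeal) :=
    IsLocalization.isDomain_localization hle
  obtain ⟨_, a, b, -, -, hb, hab', hab⟩ := Proj.exists_generic_value_eq_div hη hη₀ _ hP
  obtain ⟨_, c, d, -, -, hd, hcd', hcd⟩ := Proj.exists_generic_value_eq_div hη hη₁ _ hQ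
  obtain ⟨p, hp, hirr, hpT, hpS⟩ := MvPolynomial.exists_isPrime_mem_denominators (by omega)
    (IsLocalization.injective _ hle) hTS _ _ P.isPrime Q.isPrime hab
    (not_not.mp (hab'.not.mp hP')) hb hcd (not_not.mp (hcd'.not.mp hQ')) hd
  -- `p` may fail to be homogeneous. Its homogeneous core is still prime and keeps the homogeneous
  -- denominators, the only ones that local fractions have.
  let q : Proj (homogeneousSubmodule (Fin (n + 1)) ℂ) :=
    { asHomogeneousIdeal := p.homogeneousCore _
      isPrime := hp.homogeneousCore
      not_irrelevant_le := fun h ↦ hirr (le_trans h (Ideal.toIdeal_homogeneousCore_le _ _)) }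
  by_cases h₀ : (X 0 : MvPolynomial (Fin (1 + 1)) ℂ) ∈ (f q).asHomogeneousIdeal
  · by_cases h₁ : (X 1 : MvPolynomial (Fin (1 + 1)) ℂ) ∈ (f q).asHomogeneousIdeal
    · refine (f q).not_irrelevant_le ((irrelevant_le_idealOfVars _).trans ?_)
      rw [idealOfVars, Ideal.span_le, Set.range_subset_iff]
      exact Fin.forall_fin_two.mpr ⟨h₀, h₁⟩
    · obtain ⟨i, x, y, -, hy, hyq, -, h⟩ := Proj.exists_generic_value_eq_div hη hη₁
        (f.app _ (Proj.fraction (hX 1) (hX 0))) (x := q) h₁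
      exact hyq (Ideal.mem_homogeneousCore_of_homogeneous_of_mem ⟨i, hy⟩ (hpS x y h))
  · obtain ⟨i, x, y, -, hy, hyq, -, h⟩ := Proj.exists_generic_value_eq_div hη hη₀
      (f.app _ (Proj.fraction (hX 0) (hX 1))) (x := q) h₀
    exact hyq (Ideal.mem_homogeneousCore_of_homogeneous_of_mem ⟨i, hy⟩ (hpT x y h))
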